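/- Let $k$ be an arbitrary field, and view the affine plane $\mathbb A^2(k)$ as embedded in $\mathbb P^2(k)$; write $\langle X,Y\rangle$ for the line through $X\neq Y$. Lines are said to lie in a pencil if they are concurrent or parallel, that is, if they share a (finite or infinite) point of $\mathbb P^2(k)$, the center of the pencil. If $P,Q,R,S$ are finite points on a line $l$ with $R,S\notin\{P,Q\}$, let $C=[P,Q\mid R,S]$ denote the (finite or infinite) point of $l$ determined by $$\frac{C-Q}{C-R}=\frac{Q-S}{R-P},$$ where the left-hand side is understood to be $1$ if $C$ is the point at infinity of $l$. Let $n\ge 5$ and let $A_1,\dots,A_n$ be distinct points of $\mathbb A^2(k)$. Put $l_i=\langle A_{i-1},A_{i+1}\rangle$, with indices modulo $n$, and assume that for all $i$ (i) $A_i\notin l_{i-2}$, $A_i\notin l_i$ and $A_i\notin l_{i+2}$; (ii) $l_{i-1}\neq l_{i+1}$; (iii) $l_i\nparallel l_{i+1}$. Let $B_{i,i+1}=l_i\cap l_{i+1}$, let $C_i=[A_{i-1},B_{i-1,i}\mid B_{i,i+1},A_{i+1}]$, and let $g_i=\langle A_i,C_i\rangle$ be the axis through $A_i$. If the $n-3$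 axes $g_1,g_2,\dots,g_{n-3}$ lie in a pencil, then the remaining three axes $g_{n-2}$, $g_{n-1}$, $g_n$ lie in the same pencil: every common (finite or infinite) point of $g_1,\dots,g_{n-3}$ also lies on $g_{n-2}$, $g_{n-1}$ and $g_n$. -/

import Mathlib

open scoped LinearAlgebra.Projectivization Affine

/-- The projective plane `ℙ²(k)`. -/
abbrev ProjPlane (k : Type*) [Field k] : Type _ := ℙ k (Fin 3 → k)

/-- The inclusion of the affine plane in the projective plane, `(x, y) ↦ (x : y : 1)`. -/
def finitePoint {k : Type*} [Field k] (p : k × k) : ProjPlane k :=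
  Projectivization.mk k ![p.1, p.2, 1] (fun h => one_ne_zero (congrFun h 2))

/-- A point of the projective plane is at infinity if it is not in the affine plane. -/
def AtInfinity {k : Type*} [Field k] (X : ProjPlane k) : Prop :=
  X ∉ Set.range (finitePoint (k := k))

/-- The projective line `⟨X, Y⟩` through two distinct points, as the set of its points. -/
def projLine {k : Type*} [Field k] (X Y : ProjPlane k) : Set (ProjPlane k) :=
  {Z | Z.submodule ≤ X.submodule ⊔ Y.submodule}

/-- `IsBracket P Q R S C` says that `C = [P, Q | R, S]`: the point `C` of the projective line
`l` through the affine points `P, Q, R, S` satisfies `(C - Q) / (C - R) = (Q - S) / (R - P)`.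
The common value of the two ratios is `t`; the left-hand ratio is by convention `1` when
`C` is the point at infinity of `l`. -/
def IsBracket {k : Type*} [Field k] (P Q R S : k × k) (C : ProjPlane k) : Prop :=
  C ∈ projLine (finitePoint P) (finitePoint S) ∧
  ∃ t : k, Q - S = t • (R - P) ∧
    ((∃ c : k × k, C = finitePoint c ∧ c - Q = t • (c - R)) ∨ (AtInfinity C ∧ t = 1))

/-- The line `l_i = ⟨A_{i-1}, A_{i+1}⟩` of the affine plane, indices modulo `n`. -/
def diagLine {k : Type*} [Field k] {n : ℕ} (A : ZMod n → k × k) (i : ZMod n) :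
    AffineSubspace k (k × k) :=
  line[k, A (i - 1), A (i + 1)]

/-! The polygon is self-polar: some nonzero symmetric bilinear form σ on k³ makes consecutive
vertices conjugate, while σ(m, ·) kills all directions, so that the pencil center m is a (possibly
degenerate) conic center. Such forms make up a 6-dimensional space. Two linear conditions fix the
center and three make the sides from A_{-1} to A_2 conjugate pairs, so a nonzero σ exists. By
`OnAxis.conicForm_eq_zero`, each axis through m carries conjugacy to one further side; the n-3 given
axes thus supply the other n-3 sides. Conversely, by `OnAxis.of_conicForm`, self-polarity puts m on
every axis. Bilinear rather than quadratic forms keep characteristic 2 included. -/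

section SelfPolar

/-! ### Determinants and symmetric bilinear forms on k³ -/

variable {k : Type*} [Field k]

/-- Homogeneous coordinates `(x, y, 1)` of the affine point `(x, y)`. -/
def homCoord (p : k × k) : Fin 3 → k := ![p.1, p.2, 1]

@[simp] lemma homCoord_zero (p : k × k) : homCoord p 0 = p.1 := rfl
@[simp] lemma homCoord_one (p : k × k) : homCoord p 1 = p.2 := rfl
@[simp] lemma homCoord_two (p : k × k) : homCoord p 2 = 1 := rfl

/-- The determinant of three vectors of `k³`. -/
def det3 (x y z : Fin 3 → k) : k :=
  x 0 * (y 1 * z 2 - y 2 * z 1) - x 1 * (y 0 * z 2 - y 2 * z 0) + x 2 * (y 0 * z 1 - y 1 * z 0)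

/-- The symmetric bilinear form on `k³` with coefficient vector `s`. -/
def conicForm (s : Fin 6 → k) (x y : Fin 3 → k) : k :=
  s 0 * (x 0 * y 0) + s 1 * (x 1 * y 1) + s 2 * (x 2 * y 2) + s 3 * (x 0 * y 1 + x 1 * y 0)
    + s 4 * (x 0 * y 2 + x 2 * y 0) + s 5 * (x 1 * y 2 + x 2 * y 1)

lemma conicForm_comm (s : Fin 6 → k) (x y : Fin 3 → k) :
    conicForm s x y = conicForm s y x := by
  unfold conicForm; ring

lemma det3_rotate (x y z : Fin 3 → k) : det3 y z x = det3 x y z := by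
  unfold det3; ring

lemma det3_swap (x y z : Fin 3 → k) : det3 x z y = -det3 x y z := by
  unfold det3; ring

/-- Cramer's rule, in each coordinate. -/
lemma det3_mul_apply (a b c d : Fin 3 → k) (j : Fin 3) :
    det3 a b c * d j = det3 d b c * a j + det3 a d c * b j + det3 a b d * c j := by
  fin_cases j <;> simp [det3] <;> ring

lemma det3_mul_conicForm (s : Fin 6 → k) (a b c d x : Fin 3 → k) :
    det3 a b c * conicForm s x d =
      det3 d b c * conicForm s x a + det3 a d c * conicForm s x b + det3 a b d * conicForm s x c := by
  have h0 := det3_mul_apply a b c d 0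
  have h1 := det3_mul_apply a b c d 1
  have h2 := det3_mul_apply a b c d 2
  unfold conicForm
  linear_combination (s 0 * x 0 + s 3 * x 1 + s 4 * x 2) * h0
    + (s 3 * x 0 + s 1 * x 1 + s 5 * x 2) * h1 + (s 4 * x 0 + s 5 * x 1 + s 2 * x 2) * h2

/-- Five linear conditions on symmetric bilinear forms on `k³` have a nonzero solution. -/
lemma exists_conicForm_eq_zero (x y : Fin 5 → Fin 3 → k) :
    ∃ s : Fin 6 → k, s ≠ 0 ∧ ∀ j, conicForm s (x j) (y j) = 0 := by
  let f : (Fin 6 → k) →ₗ[k] (Fin 5 → k) :=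
    { toFun := fun s j => conicForm s (x j) (y j)
      map_add' := fun s t => by funext j; simp [conicForm]; ring
      map_smul' := fun c s => by funext j; simp [conicForm]; ring }
  have hker : LinearMap.ker f ≠ ⊥ := LinearMap.ker_ne_bot_of_finrank_lt (by simp)
  obtain ⟨s, hs, hs0⟩ := Submodule.exists_mem_ne_zero_of_ne_bot hker
  exact ⟨s, hs0, fun j => congrFun (LinearMap.mem_ker.1 hs) j⟩

lemma eq_zero_of_conicForm {s : Fin 6 → k} (h : ∀ x y, conicForm s x y = 0) : s = 0 := by
  have h00 := h ![1, 0, 0] ![1, 0, 0]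
  have h11 := h ![0, 1, 0] ![0, 1, 0]
  have h22 := h ![0, 0, 1] ![0, 0, 1]
  have h01 := h ![1, 0, 0] ![0, 1, 0]
  have h02 := h ![1, 0, 0] ![0, 0, 1]
  have h12 := h ![0, 1, 0] ![0, 0, 1]
  simp [conicForm] at h00 h11 h22 h01 h02 h12
  funext j
  fin_cases j <;> assumption

/-! ### Axes and conjugacy -/

/-- The equation expressing that `m` lies on the axis through `r` of a polygon having the five
consecutive vertices `p, q, r, s, t`. -/
def OnAxis (p q r s t m : Fin 3 → k) : Prop :=
  det3 r s m * det3 q r t * (det3 p q r + det3 p r s) =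
    det3 q r m * det3 p r s * (det3 q r t + det3 r s t)

/-- Expanding p, t and m in the basis q, r, s gives relations between σ(q,q), σ(q,s), σ(s,s) and
σ(s,t); eliminating the squares leaves σ(s,t) against σ(q,s) times the axis equation. The condition
`hm` encodes the center, since s - q is a direction. -/
lemma OnAxis.conicForm_eq_zero {σ : Fin 6 → k} {p q r s t m : Fin 3 → k}
    (h : OnAxis p q r s t m) (hqrs : det3 q r s ≠ 0) (hprs : det3 p r s ≠ 0)
    (hqrm : det3 q r m ≠ 0) (hpq : conicForm σ p q = 0)
    (hqr : conicForm σ q r = 0) (hrs : conicForm σ r s = 0)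
    (hm : conicForm σ m s = conicForm σ m q) : conicForm σ s t = 0 := by
  have e1 := det3_mul_conicForm σ q r s p q
  have e2 := det3_mul_conicForm σ q r s t s
  have e3 := det3_mul_conicForm σ q r s m q
  have e4 := det3_mul_conicForm σ q r s m s
  rw [conicForm_comm σ q p, hpq, hqr, det3_rotate p q r] at e1
  rw [conicForm_comm σ s r, hrs, conicForm_comm σ s q, ← det3_rotate t r s] at e2
  rw [hqr, conicForm_comm σ q m, ← det3_rotate m r s] at e3
  rw [conicForm_comm σ s r, hrs, conicForm_comm σ s m, conicForm_comm σ s q, hm,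
    ← det3_rotate m r s] at e4
  unfold OnAxis at h
  have key : det3 q r m * det3 p r s * (det3 q r s * conicForm σ s t) = 0 := by
    rw [e2]
    linear_combination (-conicForm σ q s) * h + det3 q r t * det3 p r s * (e3 - e4)
      - det3 r s m * det3 q r t * e1
  simpa [hqrs, hprs, hqrm] using key

/-- The same elimination yields σ(q,s) times the axis equation, so the point is that σ(q,s) ≠ 0;
this is what the extra vertex u is for. -/
lemma OnAxis.of_conicForm {σ : Fin 6 → k} {p q r s t u m : Fin 3 → k}
    (hσ : σ ≠ 0) (hqrs : det3 q r s ≠ 0) (hprs : det3 p r s ≠ 0) (hqrt : det3 q r t ≠ 0)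
    (hqst : det3 q s t ≠ 0) (hqsu : det3 q s u ≠ 0) (hpq : conicForm σ p q = 0)
    (hqr : conicForm σ q r = 0) (hrs : conicForm σ r s = 0) (hst : conicForm σ s t = 0)
    (htu : conicForm σ t u = 0) (hm : conicForm σ m s = conicForm σ m q) :
    OnAxis p q r s t m := by
  have e1 := det3_mul_conicForm σ q r s p q
  have e2 := det3_mul_conicForm σ q r s t s
  have e3 := det3_mul_conicForm σ q r s m q
  have e4 := det3_mul_conicForm σ q r s m s
  rw [conicForm_comm σ q p, hpq, hqr, det3_rotate p q r] at e1
  rw [conicForm_comm σ s r, hrs, conicForm_comm σ s q, ← det3_rotate t r s, hst] at e2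
  rw [hqr, conicForm_comm σ q m, ← det3_rotate m r s] at e3
  rw [conicForm_comm σ s r, hrs, conicForm_comm σ s m, conicForm_comm σ s q, hm,
    ← det3_rotate m r s] at e4
  -- Otherwise q and s lie in the radical, so σ(x,y) is a multiple of det(q,x,s) det(q,y,s). As t
  -- and u are off the line qs, σ(t,u) = 0 forces σ = 0.
  have hb : conicForm σ q s ≠ 0 := by
    intro hb
    have hα : conicForm σ q q = 0 := by simpa [hb, hprs] using e1
    have hγ : conicForm σ s s = 0 := by simpa [hb, hqrt] using e2
    have hq : ∀ x, conicForm σ q x = 0 := fun x => by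
      simpa [hb, hα, hqr, hqrs] using det3_mul_conicForm σ q r s x q
    have hs : ∀ x, conicForm σ s x = 0 := fun x => by
      simpa [conicForm_comm σ s q, conicForm_comm σ s r, hb, hγ, hrs, hqrs]
        using det3_mul_conicForm σ q r s x s
    have hr : ∀ x, det3 q r s * conicForm σ x r = det3 q x s * conicForm σ r r := fun x => by
      rw [conicForm_comm σ x r, det3_mul_conicForm σ q r s x r, conicForm_comm σ r q, hqr, hrs]
      ring
    have hxy : ∀ x y, det3 q r s * (det3 q r s * conicForm σ x y) =
        det3 q y s * (det3 q x s * conicForm σ r r) := fun x y => by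
      rw [det3_mul_conicForm σ q r s y x, conicForm_comm σ x q, hq, conicForm_comm σ x s, hs]
      linear_combination det3 q y s * hr x
    have hrr : conicForm σ r r = 0 := by
      have := hxy t u
      rw [htu, det3_swap q s t, det3_swap q s u] at this
      simpa [hqst, hqsu] using this
    refine hσ (eq_zero_of_conicForm fun x y => ?_)
    simpa [hrr, hqrs] using hxy x y
  unfold OnAxis
  refine mul_left_cancel₀ hb ?_
  linear_combination det3 q r t * det3 p r s * (e3 - e4)
      - det3 r s m * det3 q r t * e1 + det3 q r m * det3 p r s * e2

/-! ### From points and lines to coordinates -/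

lemma homCoord_ne_zero (p : k × k) : homCoord p ≠ 0 := fun h => one_ne_zero (congrFun h 2)

lemma submodule_finitePoint (p : k × k) :
    (finitePoint p).submodule = Submodule.span k {homCoord p} :=
  Projectivization.submodule_mk _ _

lemma mem_projLine_finitePoint_iff {p : k × k} {X Z : ProjPlane k} :
    Z ∈ projLine (finitePoint p) X ↔ ∃ x y : k, x • homCoord p + y • X.rep = Z.rep := by
  rw [projLine, Set.mem_ofPred_eq, submodule_finitePoint, Projectivization.submodule_eq X,
    Projectivization.submodule_eq Z, Submodule.span_singleton_le_iff_mem, ← Submodule.span_insert,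
    Submodule.mem_span_pair]

lemma mem_projLine_finitePoint_finitePoint_iff {p q : k × k} {Z : ProjPlane k} :
    Z ∈ projLine (finitePoint p) (finitePoint q) ↔
      ∃ x y : k, x • homCoord p + y • homCoord q = Z.rep := by
  rw [projLine, Set.mem_ofPred_eq, submodule_finitePoint, submodule_finitePoint,
    Projectivization.submodule_eq Z, Submodule.span_singleton_le_iff_mem, ← Submodule.span_insert,
    Submodule.mem_span_pair]

lemma rep_finitePoint (p : k × k) : ∃ e : k, e ≠ 0 ∧ (finitePoint p).rep = e • homCoord p := by
  obtain ⟨e, he⟩ := Projectivization.exists_smul_eq_mk_rep k (homCoord p) (homCoord_ne_zero p)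
  exact ⟨e, e.ne_zero, he.symm⟩

lemma AtInfinity.rep_two_eq_zero {X : ProjPlane k} (hX : AtInfinity X) : X.rep 2 = 0 := by
  by_contra h
  refine hX ⟨(X.rep 0 / X.rep 2, X.rep 1 / X.rep 2), ?_⟩
  rw [← X.mk_rep]
  refine (Projectivization.mk_eq_mk_iff' k _ _ _ X.rep_nonzero).2 ⟨(X.rep 2)⁻¹, ?_⟩
  rw [X.mk_rep]
  funext j
  fin_cases j <;> simp [h] <;> field_simp

lemma mem_line_of_det3_eq_zero {p q x : k × k} (hpq : p ≠ q)
    (h : det3 (homCoord p) (homCoord q) (homCoord x) = 0) : x ∈ line[k, p, q] := by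
  obtain ⟨p1, p2⟩ := p
  obtain ⟨q1, q2⟩ := q
  obtain ⟨x1, x2⟩ := x
  simp only [det3, homCoord_zero, homCoord_one, homCoord_two] at h
  rw [mem_affineSpan_pair_iff_exists_lineMap_eq]
  simp only [AffineMap.lineMap_apply, vsub_eq_sub, vadd_eq_add, Prod.mk_sub_mk, Prod.smul_mk,
    smul_eq_mul, Prod.mk_add_mk, Prod.mk.injEq]
  by_cases h1 : q1 - p1 = 0
  · have h2 : q2 - p2 ≠ 0 := fun h2 =>
      hpq (by rw [Prod.mk.injEq]; exact ⟨(sub_eq_zero.1 h1).symm, (sub_eq_zero.1 h2).symm⟩)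
    refine ⟨(x2 - p2) / (q2 - p2), ?_, by field_simp; ring⟩
    field_simp
    linear_combination h
  · refine ⟨(x1 - p1) / (q1 - p1), by field_simp; ring, ?_⟩
    field_simp
    linear_combination -h

lemma line_parallel_of_cross_eq_zero {p q r s : k × k} (hpr : p ≠ r) (hqs : q ≠ s)
    (h : (r.1 - p.1) * (s.2 - q.2) - (r.2 - p.2) * (s.1 - q.1) = 0) :
    line[k, p, r].Parallel line[k, q, s] := by
  rw [AffineSubspace.affineSpan_pair_parallel_iff_vectorSpan_eq, vectorSpan_pair_rev,
    vectorSpan_pair_rev]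
  have hu : r - p ≠ 0 := sub_ne_zero.2 hpr.symm
  have hv : s - q ≠ 0 := sub_ne_zero.2 hqs.symm
  have hc : ∃ c : k, c • (r - p) = s - q := by
    by_cases h1 : r.1 - p.1 = 0
    · have h2 : r.2 - p.2 ≠ 0 := fun h2 => hu (Prod.ext h1 h2)
      refine ⟨(s.2 - q.2) / (r.2 - p.2), Prod.ext ?_ ?_⟩
      · simp only [Prod.smul_fst, Prod.fst_sub, smul_eq_mul]
        field_simp
        linear_combination h
      · simp only [Prod.smul_snd, Prod.snd_sub, smul_eq_mul]
        field_simp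
    · refine ⟨(s.1 - q.1) / (r.1 - p.1), Prod.ext ?_ ?_⟩
      · simp only [Prod.smul_fst, Prod.fst_sub, smul_eq_mul]
        field_simp
      · simp only [Prod.smul_snd, Prod.snd_sub, smul_eq_mul]
        field_simp
        linear_combination -h
  obtain ⟨c, hc⟩ := hc
  have hc0 : c ≠ 0 := by rintro rfl; exact hv (by rw [← hc, zero_smul])
  rw [vsub_eq_sub, vsub_eq_sub, ← hc, Submodule.span_singleton_smul_eq (IsUnit.mk0 c hc0)]

/-! ### The bracket point and the equation of an axis -/

/-- The position on the line `pr` of its intersection with the line `qs`. -/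
lemma lineMap_coeff_mul_eq {p q r s b : k × k} (h1 : b ∈ line[k, p, r]) (h2 : b ∈ line[k, q, s]) :
    ∃ c : k, AffineMap.lineMap p r c = b ∧
      c * (det3 (homCoord p) (homCoord q) (homCoord s) +
        det3 (homCoord q) (homCoord r) (homCoord s)) =
      det3 (homCoord p) (homCoord q) (homCoord s) := by
  obtain ⟨c, hc⟩ := mem_affineSpan_pair_iff_exists_lineMap_eq.1 h1
  obtain ⟨d, hd⟩ := mem_affineSpan_pair_iff_exists_lineMap_eq.1 h2
  refine ⟨c, hc, ?_⟩
  rw [← hd] at hc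
  have e1 := congrArg Prod.fst hc
  have e2 := congrArg Prod.snd hc
  simp [AffineMap.lineMap_apply] at e1 e2
  simp only [det3, homCoord_zero, homCoord_one, homCoord_two]
  linear_combination (s.2 - q.2) * e1 - (s.1 - q.1) * e2

/-- Coordinates of the point `[P, Q | R, S]` with respect to `P` and `S`. -/
lemma IsBracket.exists_rep {P S : k × k} (hPS : P ≠ S) {r w : k} {C : ProjPlane k}
    (h : IsBracket P (AffineMap.lineMap S P w) (AffineMap.lineMap P S r) S C) :
    ∃ x y : k, x • homCoord P + y • homCoord S = C.rep ∧ x * r = y * w := by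
  obtain ⟨hC, t, ht, hc⟩ := h
  obtain ⟨x, y, hxy⟩ := mem_projLine_finitePoint_finitePoint_iff.1 hC
  refine ⟨x, y, hxy, ?_⟩
  have cancel : ∀ d : k, d * (S.1 - P.1) = 0 → d * (S.2 - P.2) = 0 → d = 0 := by
    intro d h1 h2
    by_contra hd
    refine hPS (Prod.ext ?_ ?_)
    · simpa [hd, sub_eq_zero, eq_comm] using h1
    · simpa [hd, sub_eq_zero, eq_comm] using h2
  have t1 := congrArg Prod.fst ht
  have t2 := congrArg Prod.snd ht
  simp [AffineMap.lineMap_apply] at t1 t2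
  have hw : w + t * r = 0 := cancel _ (by linear_combination -t1) (by linear_combination -t2)
  rcases hc with ⟨c, rfl, hc⟩ | ⟨hinf, rfl⟩
  · obtain ⟨e, -, he⟩ := rep_finitePoint c
    rw [he] at hxy
    have e0 := congrFun hxy 0
    have e1 := congrFun hxy 1
    have e2 := congrFun hxy 2
    have c1 := congrArg Prod.fst hc
    have c2 := congrArg Prod.snd hc
    simp [AffineMap.lineMap_apply] at e0 e1 e2 c1 c2
    -- For C at infinity, t = 1 and this is the vanishing of the last coordinate, so both cases end
    -- alike.
    have hx : x + t * y = 0 := by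
      refine cancel _ ?_ ?_
      · linear_combination (-e) * c1 - (1 - t) * e0 + ((1 - t) * P.1 + (S.1 - P.1)) * e2
          + e * (S.1 - P.1) * hw
      · linear_combination (-e) * c2 - (1 - t) * e1 + ((1 - t) * P.2 + (S.2 - P.2)) * e2
          + e * (S.2 - P.2) * hw
    linear_combination r * hx - y * hw
  · have e2 := congrFun hxy 2
    rw [hinf.rep_two_eq_zero] at e2
    simp at e2
    linear_combination r * e2 - y * hw

/-- For five consecutive vertices of a polygon, membership in the axis through the middle one. -/
lemma mem_axis_iff {P Q R S T b b' : k × k} {C M : ProjPlane k} (hQS : Q ≠ S)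
    (hQRS : det3 (homCoord Q) (homCoord R) (homCoord S) ≠ 0)
    (hPRS : det3 (homCoord P) (homCoord R) (homCoord S) ≠ 0)
    (hQRT : det3 (homCoord Q) (homCoord R) (homCoord T) ≠ 0)
    (hD : det3 (homCoord P) (homCoord Q) (homCoord R) +
      det3 (homCoord P) (homCoord R) (homCoord S) ≠ 0)
    (hD' : det3 (homCoord Q) (homCoord R) (homCoord T) +
      det3 (homCoord R) (homCoord S) (homCoord T) ≠ 0)
    (hb1 : b ∈ line[k, P, R]) (hb2 : b ∈ line[k, Q, S])
    (hb1' : b' ∈ line[k, Q, S]) (hb2' : b' ∈ line[k, R, T])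
    (hC : IsBracket Q b b' S C) :
    M ∈ projLine (finitePoint R) C ↔
      OnAxis (homCoord P) (homCoord Q) (homCoord R) (homCoord S) (homCoord T) M.rep := by
  rw [Set.pair_comm Q S] at hb2
  rw [Set.pair_comm P R] at hb1
  obtain ⟨w, rfl, hw⟩ := lineMap_coeff_mul_eq hb2 hb1
  obtain ⟨r, rfl, hr⟩ := lineMap_coeff_mul_eq hb1' hb2'
  obtain ⟨x, y, hxy, hxr⟩ := hC.exists_rep hQS
  have e1 : det3 (homCoord S) (homCoord R) (homCoord P) =
      -det3 (homCoord P) (homCoord R) (homCoord S) := by unfold det3; ring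
  have e2 : det3 (homCoord R) (homCoord Q) (homCoord P) =
      -det3 (homCoord P) (homCoord Q) (homCoord R) := by unfold det3; ring
  rw [e1, e2] at hw
  rw [mem_projLine_finitePoint_iff]
  have hC0 := C.rep_nonzero
  generalize C.rep = c at *
  generalize M.rep = m at *
  generalize homCoord P = p at *
  generalize homCoord Q = q at *
  generalize homCoord R = a at *
  generalize homCoord S = s at *
  generalize homCoord T = d at *
  have hw0 : w ≠ 0 := by rintro rfl; exact hPRS (by linear_combination hw)
  have hr0 : r ≠ 0 := by rintro rfl; exact hQRT (by linear_combination -hr)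
  subst hxy
  unfold OnAxis
  constructor
  · rintro ⟨u, v, rfl⟩
    have h1 : det3 a s (u • a + v • (x • q + y • s)) = v * x * det3 q a s := by
      simp [det3]; ring
    have h2 : det3 q a (u • a + v • (x • q + y • s)) = v * y * det3 q a s := by
      simp [det3]; ring
    rw [h1, h2]
    linear_combination (v * det3 q a s) * (-x * (det3 p q a + det3 p a s) * hr
      - y * (det3 q a d + det3 a s d) * hw + (det3 p q a + det3 p a s) *
        (det3 q a d + det3 a s d) * hxr)
  · intro h
    -- By `hr` and `hw`, the axis equation is this one multiplied by both denominators.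
    have h' : det3 a s m * r = det3 q a m * w := by
      refine mul_right_cancel₀ (mul_ne_zero hD hD') ?_
      linear_combination h + det3 a s m * (det3 p q a + det3 p a s) * hr
        + det3 q a m * (det3 q a d + det3 a s d) * hw
    have hy : y ≠ 0 := by
      rintro rfl
      have hx : x = 0 := by simpa [hr0] using hxr
      exact hC0 (by simp [hx])
    have h'' : det3 q a m * x = det3 a s m * y :=
      mul_right_cancel₀ hw0 (by linear_combination det3 a s m * hxr - x * h')
    -- Cramer coefficients of m in the basis q, a, s; the s-coefficient is divided by y.
    refine ⟨det3 q m s / det3 q a s, det3 q a m / (det3 q a s * y), ?_⟩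
    funext j
    have hj := det3_mul_apply q a s m j
    rw [← det3_rotate m a s] at hj
    simp only [Pi.add_apply, Pi.smul_apply, smul_eq_mul]
    field_simp
    linear_combination q j * h'' - y * hj

/-! ### Propagation around the polygon -/

/-- The lines pq and qr meet only in q, which is not on rs. -/
lemma eq_zero_of_det3_eq_zero {p q r s m : Fin 3 → k} (hpqr : det3 p q r ≠ 0)
    (hqrs : det3 q r s ≠ 0) (h1 : det3 p q m = 0) (h2 : det3 q r m = 0) (h3 : det3 r s m = 0) :
    m = 0 := by
  have hm : ∀ j, det3 p q r * m j = det3 p m r * q j := fun j => by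
    rw [det3_mul_apply p q r m j, ← det3_rotate m q r, h1, h2]
    ring
  have h4 : det3 p m r * det3 q r s = 0 := by
    have h5 : det3 p q r * det3 r s m = det3 p m r * det3 q r s := by
      have e0 := hm 0
      have e1 := hm 1
      have e2 := hm 2
      rw [← det3_rotate q r s]
      generalize det3 p q r = x at *
      generalize det3 p m r = y at *
      unfold det3
      linear_combination (r 1 * s 2 - r 2 * s 1) * e0 + (r 2 * s 0 - r 0 * s 2) * e1
        + (r 0 * s 1 - r 1 * s 0) * e2
    rw [← h5, h3, mul_zero]
  have h6 : det3 p m r = 0 := by simpa [hqrs] using h4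
  funext j
  simpa [h6, hpqr] using hm j

/-- If all but three consecutive axes of a polygon pass through `m`, then the polygon is self-polar
with respect to a conic of centre `m`, so all axes pass through `m`. -/
lemma onAxis_of_onAxis {n : ℕ} (hn : 5 ≤ n) (a : ZMod n → Fin 3 → k) {m : Fin 3 → k} (hm0 : m ≠ 0)
    (haff : ∀ i, a i 2 = 1)
    (hp : ∀ i, det3 (a i) (a (i + 1)) (a (i + 2)) ≠ 0)
    (hU : ∀ i, det3 (a i) (a (i + 1)) (a (i + 3)) ≠ 0)
    (hV : ∀ i, det3 (a i) (a (i + 2)) (a (i + 3)) ≠ 0)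
    (hW : ∀ i, det3 (a i) (a (i + 2)) (a (i + 4)) ≠ 0)
    (hD : ∀ i, det3 (a i) (a (i + 1)) (a (i + 2)) + det3 (a i) (a (i + 2)) (a (i + 3)) ≠ 0)
    (hm : ∀ j : ℕ, j + 4 ≤ n → ∀ i : ZMod n, i = j - 1 →
      OnAxis (a i) (a (i + 1)) (a (i + 2)) (a (i + 3)) (a (i + 4)) m) (i : ZMod n) :
    OnAxis (a i) (a (i + 1)) (a (i + 2)) (a (i + 3)) (a (i + 4)) m := by
  have shift : ∀ i : ZMod n, i + 1 + 1 = i + 2 ∧ i + 1 + 2 = i + 3 ∧ i + 1 + 3 = i + 4 ∧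
      i + 2 + 1 = i + 3 ∧ i + 3 + 1 = i + 4 ∧ i + 1 + 4 = i + 5 ∧ i + 4 + 1 = i + 5 := fun i => by
    refine ⟨?_, ?_, ?_, ?_, ?_, ?_, ?_⟩ <;> ring
  have shiftE : ∀ i, OnAxis (a i) (a (i + 1)) (a (i + 2)) (a (i + 3)) (a (i + 4)) m →
      (det3 (a (i + 1)) (a (i + 2)) m = 0 ↔ det3 (a (i + 2)) (a (i + 3)) m = 0) := fun i h => by
    have hUi := hU (i + 1)
    have hDi := hD (i + 1)
    obtain ⟨s1, s2, s3, -⟩ := shift i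
    rw [s1, s3] at hUi
    rw [s1, s2, s3] at hDi
    -- The two triangulations of a quadrilateral have the same signed area.
    have hDi' : det3 (a (i + 1)) (a (i + 2)) (a (i + 4)) +
        det3 (a (i + 2)) (a (i + 3)) (a (i + 4)) ≠ 0 := by
      convert hDi using 1
      simp only [det3, haff]
      ring
    unfold OnAxis at h
    constructor
    · intro h0
      rw [h0] at h
      simpa [hUi, hD i] using h
    · intro h0
      rw [h0] at h
      simpa [hV i, hDi', eq_comm] using h
  have cast_shift : ∀ j : ℕ, ((j + 1 : ℕ) : ZMod n) - 1 = (j : ZMod n) - 1 + 1 := fun j => by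
    push_cast; ring
  -- If m were on this side, the first two axes would put it on the next two sides as well; n ≥ 5
  -- guarantees two axes.
  have hE : det3 (a (-1 + 1)) (a (-1 + 2)) m ≠ 0 := by
    intro h1
    have g1 := hm 0 (by omega) (-1) (by simp)
    have g2 := hm 1 (by omega) (-1 + 1) (by simp)
    have h2 := (shiftE _ g1).1 h1
    have h3 := (shiftE _ g2).1
    obtain ⟨s1, s2, s3, -⟩ := shift (-1 : ZMod n)
    have p1 := hp (-1 + 1)
    have p2 := hp (-1 + 2)
    rw [s1, s2] at h3 p1
    rw [show (-1 + 2 + 1 : ZMod n) = -1 + 3 by ring,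
      show (-1 + 2 + 2 : ZMod n) = -1 + 1 + 3 by ring] at p2
    exact hm0 (eq_zero_of_det3_eq_zero p1 p2 h1 h2 (h3 h2))
  obtain ⟨σ, hσ, hz⟩ := exists_conicForm_eq_zero
    ![m, m, a (-1), a (-1 + 1), a (-1 + 2)] ![![1, 0, 0], ![0, 1, 0], a (-1 + 1), a (-1 + 2), a (-1 + 3)]
  have hmx : ∀ x y : Fin 3 → k, x 2 = y 2 → conicForm σ m x = conicForm σ m y := by
    intro x y hxy
    have z0 := hz 0
    have z1 := hz 1
    simp [conicForm] at z0 z1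
    unfold conicForm
    linear_combination (x 0 - y 0) * z0 + (x 1 - y 1) * z1
      + (σ 2 * m 2 + σ 4 * m 0 + σ 5 * m 1) * hxy
  -- Three consecutive sides are carried along, starting at A_{j-1}; the last window, j = n - 3,
  -- ends at A_{n-1} = A_{-1} and closes the polygon.
  have hconj : ∀ j : ℕ, j + 3 ≤ n → ∀ i : ZMod n, i = j - 1 →
      det3 (a (i + 1)) (a (i + 2)) m ≠ 0 ∧ conicForm σ (a i) (a (i + 1)) = 0 ∧
      conicForm σ (a (i + 1)) (a (i + 2)) = 0 ∧ conicForm σ (a (i + 2)) (a (i + 3)) = 0 := by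
    intro j
    induction j with
    | zero =>
      rintro - i rfl
      rw [Nat.cast_zero, zero_sub]
      exact ⟨hE, hz 2, hz 3, hz 4⟩
    | succ j ih =>
      rintro hj _ rfl
      obtain ⟨i, hi⟩ : ∃ i : ZMod n, i = j - 1 := ⟨_, rfl⟩
      rw [cast_shift, ← hi]
      obtain ⟨hEi, c1, c2, c3⟩ := ih (by omega) i hi
      have hg := hm j (by omega) i hi
      have hpi := hp (i + 1)
      obtain ⟨s1, s2, s3, -⟩ := shift i
      rw [s1, s2] at hpi
      rw [s1, s2, s3]
      refine ⟨fun h => hEi ((shiftE i hg).2 h), c2, c3, ?_⟩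
      exact hg.conicForm_eq_zero hpi (hV i) hEi c1 c2 c3 (hmx _ _ (by rw [haff, haff]))
  have hall : ∀ i, conicForm σ (a i) (a (i + 1)) = 0 := by
    intro i
    have : NeZero n := ⟨by omega⟩
    have hlt := ZMod.val_lt (i + 1)
    have hval : ((i + 1).val : ZMod n) = i + 1 := ZMod.natCast_zmod_val _
    generalize (i + 1).val = j at hlt hval
    have hi : i = (j : ZMod n) - 1 := by rw [hval]; ring
    by_cases h1 : j + 3 ≤ n
    · exact (hconj j h1 i hi).2.1
    · obtain ⟨N, rfl⟩ : ∃ N, n = N + 3 := ⟨n - 3, by omega⟩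
      obtain ⟨-, -, c2, c3⟩ := hconj N le_rfl _ rfl
      obtain rfl | rfl : j = N + 1 ∨ j = N + 2 := by omega
      · have : i = (N : ZMod (N + 3)) - 1 + 1 := by rw [hi]; push_cast; ring
        rw [this, (shift _).1]
        exact c2
      · have : i = (N : ZMod (N + 3)) - 1 + 2 := by rw [hi]; push_cast; ring
        rw [this, (shift _).2.2.2.1]
        exact c3
  obtain ⟨s1, s2, s3, s4, s5, s6, s7⟩ := shift i
  have c2 := hall (i + 1)
  have c3 := hall (i + 2)
  have c4 := hall (i + 3)
  have c5 := hall (i + 4)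
  have hpi := hp (i + 1)
  have hUi := hU (i + 1)
  have hVi := hV (i + 1)
  have hWi := hW (i + 1)
  rw [s1] at c2 hpi hUi
  rw [s4] at c3
  rw [s5] at c4
  rw [s7] at c5
  rw [s2] at hpi hVi hWi
  rw [s3] at hUi hVi
  rw [s6] at hWi
  exact OnAxis.of_conicForm hσ hpi (hV i) hUi hVi hWi (hall i) c2 c3 c4 c5
    (hmx _ _ (by rw [haff, haff]))

end SelfPolar

/-! ### Translating the incidence hypotheses -/

theorem theorem3p1 {k : Type*} [Field k] {n : ℕ} (hn : 5 ≤ n)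
    (A : ZMod n → k × k) (hA : Function.Injective A)
    (h1 : ∀ i, A i ∉ diagLine A (i - 2) ∧ A i ∉ diagLine A i ∧ A i ∉ diagLine A (i + 2))
    (h2 : ∀ i, diagLine A (i - 1) ≠ diagLine A (i + 1))
    (h3 : ∀ i, ¬ (diagLine A i).Parallel (diagLine A (i + 1)))
    (B : ZMod n → k × k)
    (hB : ∀ i, B i ∈ diagLine A i ∧ B i ∈ diagLine A (i + 1))
    (C : ZMod n → ProjPlane k)
    (hC : ∀ i, IsBracket (A (i - 1)) (B (i - 1)) (B i) (A (i + 1)) (C i))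
    (g : ZMod n → Set (ProjPlane k))
    (hg : ∀ i, g i = projLine (finitePoint (A i)) (C i))
    (M : ProjPlane k)
    (hM : ∀ i : ℕ, 1 ≤ i → i + 3 ≤ n → M ∈ g (i : ZMod n)) :
    M ∈ g ((n - 2 : ℕ) : ZMod n) ∧ M ∈ g ((n - 1 : ℕ) : ZMod n) ∧ M ∈ g (n : ZMod n) := by
  have two_ne : (2 : ZMod n) ≠ 0 := by
    intro h
    have h' : ((2 : ℕ) : ZMod n) = 0 := by exact_mod_cast h
    have := Nat.le_of_dvd (by norm_num) ((ZMod.natCast_eq_zero_iff 2 n).1 h')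
    omega
  have hne : ∀ i, A i ≠ A (i + 2) := fun i h => two_ne (by simpa using hA h)
  have hl : ∀ i, diagLine A (i + 1) = line[k, A i, A (i + 2)] := fun i => by
    rw [diagLine, add_sub_cancel_right, add_assoc, one_add_one_eq_two]
  have hl' : ∀ i j, j = i + 1 → diagLine A j = line[k, A i, A (i + 2)] := by
    rintro i _ rfl; exact hl i
  let a : ZMod n → Fin 3 → k := fun i => homCoord (A i)
  have hp : ∀ i, det3 (a i) (a (i + 1)) (a (i + 2)) ≠ 0 := fun i h => by
    refine (h1 (i + 1)).2.1 ?_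
    rw [hl]
    exact mem_line_of_det3_eq_zero (hne i) (by rw [det3_swap]; exact neg_eq_zero.2 h)
  have hU : ∀ i, det3 (a i) (a (i + 1)) (a (i + 3)) ≠ 0 := fun i h => by
    refine (h1 i).2.2 ?_
    rw [hl' (i + 1) _ (by ring)]
    refine mem_line_of_det3_eq_zero (hne _) ?_
    rw [det3_rotate, show i + 1 + 2 = i + 3 by ring]
    exact h
  have hV : ∀ i, det3 (a i) (a (i + 2)) (a (i + 3)) ≠ 0 := fun i h => by
    refine (h1 (i + 3)).1 ?_
    rw [hl' i _ (by ring)]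
    exact mem_line_of_det3_eq_zero (hne _) h
  have hW : ∀ i, det3 (a i) (a (i + 2)) (a (i + 4)) ≠ 0 := fun i h => by
    refine h2 (i + 2) ?_
    have s : i + 2 + 2 = i + 4 := by ring
    rw [hl' i _ (by ring), hl, s]
    have hne' := hne (i + 2)
    rw [s] at hne'
    apply le_antisymm
    · refine affineSpan_pair_le_of_mem_of_mem ?_ (left_mem_affineSpan_pair _ _ _)
      exact mem_line_of_det3_eq_zero hne' (by rw [det3_rotate]; exact h)
    · refine affineSpan_pair_le_of_mem_of_mem (right_mem_affineSpan_pair _ _ _) ?_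
      exact mem_line_of_det3_eq_zero (hne i) h
  -- This sum is the cross product of the two diagonals of A_i A_{i+1} A_{i+2} A_{i+3}.
  have hD : ∀ i, det3 (a i) (a (i + 1)) (a (i + 2)) + det3 (a i) (a (i + 2)) (a (i + 3)) ≠ 0 :=
    fun i h => by
    refine h3 (i + 1) ?_
    have s : i + 1 + 2 = i + 3 := by ring
    have hne' := hne (i + 1)
    rw [hl, hl, s]
    rw [s] at hne'
    refine line_parallel_of_cross_eq_zero (hne i) hne' ?_
    simp only [a, det3, homCoord_zero, homCoord_one, homCoord_two] at h
    linear_combination h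
  have haxis : ∀ i, M ∈ g (i + 2) ↔
      OnAxis (a i) (a (i + 1)) (a (i + 2)) (a (i + 3)) (a (i + 4)) M.rep := by
    intro i
    have s1 : i + 2 - 1 = i + 1 := by ring
    have s2 : i + 2 + 1 = i + 3 := by ring
    have t1 : i + 1 + 1 = i + 2 := by ring
    have t2 : i + 1 + 2 = i + 3 := by ring
    have t3 : i + 1 + 3 = i + 4 := by ring
    have t4 : i + 2 + 2 = i + 4 := by ring
    have hBi := hB (i + 1)
    have hBi' := hB (i + 2)
    have hCi := hC (i + 2)
    have hpi := hp (i + 1)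
    have hUi := hU (i + 1)
    have hDi := hD (i + 1)
    have hnei := hne (i + 1)
    rw [hl, hl' (i + 1) _ rfl, t2] at hBi
    rw [hl' (i + 1) (i + 2) t1.symm, hl, t2, t4] at hBi'
    rw [s1, s2] at hCi
    rw [t1, t2] at hpi
    rw [t1, t3] at hUi
    rw [t1, t2, t3] at hDi
    rw [t2] at hnei
    rw [hg]
    refine mem_axis_iff hnei hpi (hV i) hUi (hD i) ?_ hBi.1 hBi.2 hBi'.1 hBi'.2 hCi
    convert hDi using 1
    simp only [a, det3, homCoord_zero, homCoord_one, homCoord_two]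
    ring
  have main : ∀ i, M ∈ g i := by
    intro i
    have h := (haxis (i - 2)).2 (onAxis_of_onAxis hn a M.rep_nonzero (fun _ => rfl) hp hU hV hW hD
      (fun j hj i hi => (haxis i).1 ?_) (i - 2))
    · rwa [sub_add_cancel] at h
    -- The five vertices starting at A_{j-1} have A_{j+1} in the middle, so j + 4 ≤ n covers exactly
    -- g_1, ..., g_{n-3}.
    · have := hM (j + 1) (by omega) (by omega)
      rwa [show ((j + 1 : ℕ) : ZMod n) = i + 2 by rw [hi]; push_cast; ring] at this
  exact ⟨main _, main _, main _⟩
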